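/- Let $d,s\ge 1$ be integers and $J_d,J_s>0$. For a finite set $\Lambda$ of vertices of a graph whose edges carry couplings $J_{\{x,y\}}$, let $\langle\sigma_x\sigma_y\rangle_\Lambda$ denote the two-point function of the Ising model on $\Lambda$ with free boundary condition at inverse temperature $\beta=1$, i.e. spins $\sigma\in\{\pm1\}^\Lambda$ have weight proportional to $\exp\big(\sum_{\{x,y\}}J_{\{x,y\}}\sigma_x\sigma_y\big)$, the sum running over the edges with both endpoints in $\Lambda$. Put $\chi_\Lambda=\sup_{x\in\Lambda}\sum_{y\in\Lambda}\langle\sigma_x\sigma_y\rangle_\Lambda$. Let $\chi_d(J_d)=\lim_{N\to\infty}\chi_{\Lambda_N}\in[0,\infty]$ for the nearest-neighbour model on $\mathbb Z^d$ with coupling $J_d$ on every edge and $\Lambda_N=\{-N,\dots,N\}^d$. Let $\chi_{d+s}(J_d,J_s)=\lim_{N\to\infty}\chi_{\Lambda_N}\in[0,\infty]$ for the nearest-neighbour model on $\mathbb Z^{d+s}=\mathbb Z^d\times\mathbb Z^s$ with $\Lambda_N=\{-N,\dots,N\}^{d+s}$, coupling $J_d$ on the edges $\{(u,t),(u',t)\}$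 with $|u-u'|=1$, and coupling $J_s$ on the edges $\{(u,t),(u,t')\}$ with $|t-t'|=1$. Then both limits exist in $[0,\infty]$, and: if $\chi_d(J_d)<\infty$ and $$\tanh(J_s)<\frac{1}{2s\,\chi_d(J_d)},$$ then $\chi_{d+s}(J_d,J_s)<\infty$. More precisely, as an inequality in $[0,\infty]$, $$\chi_{d+s}(J_d,J_s)\le\sum_{n\ge0}\big(2s\tanh(J_s)\big)^n\,\chi_d(J_d)^{n+1}.$$ -/

import Mathlib

open Filter Topology
open scoped ENNReal

namespace AnisotropicIsing

noncomputable section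

/-! ### The ferromagnetic Ising model on a finite graph, free boundary condition, `β = 1` -/

section FiniteGraph

variable {V : Type} [Fintype V]

open scoped Classical in
/-- The Hamiltonian `H(σ) = - ∑_{ {x,y} ∈ E } J_{ {x,y} } σ_x σ_y` of a configuration `σ` of
`±1` spins on the vertices of a finite graph, with couplings `J` on its edges. -/
def hamiltonian (G : SimpleGraph V) (J : Sym2 V → ℝ) (σ : V → ℤˣ) : ℝ :=
  -∑ e ∈ G.edgeFinset, J e * Sym2.lift
    ⟨fun x y => ((σ x : ℤ) : ℝ) * ((σ y : ℤ) : ℝ), fun _ _ => mul_comm _ _⟩ e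

open scoped Classical in
/-- Integral against the uniform product probability measure on spin configurations,
`∏_x (1/2) ∑_{σ_x = ±1}`. -/
def spinIntegral (f : (V → ℤˣ) → ℝ) : ℝ :=
  (1 / 2) ^ Fintype.card V * ∑ σ : V → ℤˣ, f σ

/-- The partition function. -/
def partitionFunction (G : SimpleGraph V) (J : Sym2 V → ℝ) : ℝ :=
  spinIntegral fun σ => Real.exp (-hamiltonian G J σ)

/-- The two-point function `⟨σ_x σ_y⟩`. -/
def twoPoint (G : SimpleGraph V) (J : Sym2 V → ℝ) (x y : V) : ℝ :=
  (spinIntegral fun σ =>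
    ((σ x : ℤ) : ℝ) * ((σ y : ℤ) : ℝ) * Real.exp (-hamiltonian G J σ)) /
    partitionFunction G J

/-- The finite-volume susceptibility `sup_x ∑_y ⟨σ_x σ_y⟩`. -/
def finiteSusceptibility (G : SimpleGraph V) (J : Sym2 V → ℝ) : ℝ :=
  ⨆ x : V, ∑ y : V, twoPoint G J x y

end FiniteGraph

/-- The finite-volume susceptibility of the Ising model in a finite set `Λ` of vertices of a
(possibly infinite) graph: the edges are those with both endpoints in `Λ`. -/
def susceptibilityIn {V : Type} (G : SimpleGraph V) (J : Sym2 V → ℝ) (Λ : Finset V) : ℝ :=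
  finiteSusceptibility (V := Λ) (G.induce (Λ : Set V)) (fun e => J (e.map Subtype.val))

/-! ### The lattices -/

/-- The nearest-neighbour graph on `ℤⁿ`. -/
def latticeGraph (n : ℕ) : SimpleGraph (Fin n → ℤ) where
  Adj x y := ∑ i, |x i - y i| = 1
  symm := ⟨fun x y h => by simpa only [abs_sub_comm] using h⟩
  loopless := ⟨fun x h => by simp at h⟩

/-- The nearest-neighbour graph on `ℤ^(d+s) = ℤᵈ × ℤˢ`: `(u,t)` and `(u',t')` are joined when
`t = t'` and `|u - u'| = 1` (planar edge), or `u = u'` and `|t - t'| = 1` (vertical edge). -/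
def productGraph (d s : ℕ) : SimpleGraph ((Fin d → ℤ) × (Fin s → ℤ)) :=
  (latticeGraph d).boxProd (latticeGraph s)

open scoped Classical in
/-- The couplings on `ℤᵈ × ℤˢ`: `Jd` on planar edges and `Js` on vertical edges (the value on
pairs that are not edges is never used). -/
def coupling (d s : ℕ) (Jd Js : ℝ) (e : Sym2 ((Fin d → ℤ) × (Fin s → ℤ))) : ℝ :=
  if e ∈ ((latticeGraph d).boxProd (⊥ : SimpleGraph (Fin s → ℤ))).edgeSet then Jd else Js

/-- The cube of side length `2N+1` in `ℤⁿ`, centred at the origin. -/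
def box (n N : ℕ) : Finset (Fin n → ℤ) :=
  Finset.Icc (fun _ => -(N : ℤ)) (fun _ => (N : ℤ))

/-! ### Susceptibilities of the infinite systems

The limits `N → ∞` are taken in `[0,∞]`. They are written as upper limits, which are the limits
whenever the sequences converge. -/

/-- The finite-volume susceptibility of the Ising model on `ℤᵈ` with coupling `Jd`. -/
def chiPlanarBox (d : ℕ) (Jd : ℝ) (N : ℕ) : ℝ :=
  susceptibilityIn (latticeGraph d) (fun _ => Jd) (box d N)

/-- The finite-volume susceptibility of the anisotropic Ising model on `ℤᵈ × ℤˢ`. -/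
def chiFullBox (d s : ℕ) (Jd Js : ℝ) (N : ℕ) : ℝ :=
  susceptibilityIn (productGraph d s) (coupling d s Jd Js) (box d N ×ˢ box s N)

/-- The susceptibility `χ_d(Jd)`. -/
def chiPlanar (d : ℕ) (Jd : ℝ) : ℝ≥0∞ :=
  limsup (fun N => ENNReal.ofReal (chiPlanarBox d Jd N)) atTop

/-- The susceptibility `χ_{d+s}(Jd, Js)`. -/
def chiFull (d s : ℕ) (Jd Js : ℝ) : ℝ≥0∞ :=
  limsup (fun N => ENNReal.ofReal (chiFullBox d s Jd Js N)) atTop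

end

end AnisotropicIsing

/-!
# Susceptibility of the anisotropic Ising model

Write `r = 2 s tanh Js`. The heart of the matter is the Simon–Lieb inequality with the factor
`tanh J` (`corr_le_simon_lieb`): for sets of edges `E₁ ⊆ E`,
`⟨σ_x σ_y⟩_E ≤ ⟨σ_x σ_y⟩_{E₁} + ∑_{(u,v)} ⟨σ_x σ_u⟩_{E₁} tanh J_{uv} ⟨σ_v σ_y⟩_E`,
the sum running over the oriented edges `(u, v)` of `E \ E₁`. In a box of `ℤᵈ × ℤˢ`, take for `E₁`
the edges in the layer through `x`. Only vertical edges at vertices of that layer contribute, at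
most `2s` at each vertex `u`, so summing over `y` gives `X ≤ c + c r X` for the susceptibilities
`X` of the box and `c` of a layer (`susceptibilityIn_product_le`). As `X` is finite, this yields
`X ≤ c / (1 - r c) = ∑ₙ rⁿ cⁿ⁺¹` when `r c < 1`; otherwise the series diverges. The second Griffiths
inequality (`corr_mono`) makes both susceptibilities increase with the box, so that the limits exist
and `c` may be replaced by its limit.

All correlation inequalities come from one positivity principle: a polynomial in the spins with
nonnegative coefficients has a nonnegative sum over the configurations (`ferro`,
`sum_nonneg_of_mem_ferro`). For the Simon–Lieb inequality, take a configuration `σ` for `E` and an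
independent one `σ τ` for `E₁`. An edge `e ∈ E₁` carries the joint weight
`exp (J σ_e (1 + τ_e)) = 1 + (1 + τ_e) / 2 * (exp (2 J σ_e) - 1)`; expanding the product over `e`
gives a sum over sets `ω ⊆ E₁`, in which `τ` has to be constant on the clusters of `ω`. Summing
over `τ` turns `τ_x τ_u` into the indicator of the event that `u` lies in the cluster `C` of `x`.
If `y ∈ C`, the first term on the right suffices. If `y ∉ C`, then `σ_x σ_y` is odd under the flip
of the spins in `C`, so only the odd part of the weight `∏ (1 + σ_e tanh J_e)` of the edges of
`E \ E₁` leaving `C` counts, and each of its monomials contains at least one such edge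
(`even_odd_parts_mem`, `sum_mul_weight_le_of_odd`).
-/

namespace AnisotropicIsing

noncomputable section

section SpinSystem

open scoped Classical

variable {V : Type}

/-! ### Spins, bonds and the cone of ferromagnetic functions -/

/-- The value of the spin at `x` as a real number. -/
def spin (x : V) (σ : V → ℤˣ) : ℝ := ((σ x : ℤ) : ℝ)

/-- The product of the spins at the two ends of `e`; it is `1` if `e` is a diagonal pair. -/
def bond (e : Sym2 V) (σ : V → ℤˣ) : ℝ :=
  Sym2.lift ⟨fun x y => ((σ x : ℤ) : ℝ) * ((σ y : ℤ) : ℝ), fun _ _ => mul_comm _ _⟩ e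

lemma bond_mk (x y : V) (σ : V → ℤˣ) : bond s(x, y) σ = spin x σ * spin y σ := rfl

lemma spin_mul (x : V) (σ τ : V → ℤˣ) : spin x (σ * τ) = spin x σ * spin x τ := by
  simp [spin]

lemma spin_mul_self (x : V) (σ : V → ℤˣ) : spin x σ * spin x σ = 1 := by
  rcases Int.units_eq_one_or (σ x) with h | h <;> simp [spin, h]

lemma bond_mul (e : Sym2 V) (σ τ : V → ℤˣ) : bond e (σ * τ) = bond e σ * bond e τ := by
  induction e using Sym2.ind with
  | _ x y => simp only [bond_mk, spin_mul]; ring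

lemma bond_eq_or (e : Sym2 V) (σ : V → ℤˣ) : bond e σ = 1 ∨ bond e σ = -1 := by
  induction e using Sym2.ind with
  | _ x y =>
    rcases Int.units_eq_one_or (σ x) with h | h <;>
    rcases Int.units_eq_one_or (σ y) with h' | h' <;> simp [bond_mk, spin, h, h']

lemma exp_bond_eq (J : ℝ) (e : Sym2 V) (σ : V → ℤˣ) :
    Real.exp (J * bond e σ) = Real.cosh J + Real.sinh J * bond e σ := by
  rcases bond_eq_or e σ with h | h <;> simp [h, Real.cosh_eq, Real.sinh_eq] <;> ring

/-- The Boltzmann weight of a configuration, for the model with edges in `E`. -/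
def weight (E : Finset (Sym2 V)) (J : Sym2 V → ℝ) (σ : V → ℤˣ) : ℝ :=
  ∏ e ∈ E, Real.exp (J e * bond e σ)

lemma weight_pos (E : Finset (Sym2 V)) (J : Sym2 V → ℝ) (σ : V → ℤˣ) : 0 < weight E J σ :=
  Finset.prod_pos fun _ _ => Real.exp_pos _

lemma weight_mul_weight_sdiff {E₁ E : Finset (Sym2 V)} (hE : E₁ ⊆ E) (J : Sym2 V → ℝ)
    (σ : V → ℤˣ) : weight (E \ E₁) J σ * weight E₁ J σ = weight E J σ :=
  Finset.prod_sdiff hE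

lemma weight_congr {E : Finset (Sym2 V)} {J J' : Sym2 V → ℝ} (h : ∀ e ∈ E, J e = J' e) :
    weight E J = weight E J' := by
  ext σ
  exact Finset.prod_congr rfl fun e he => by rw [h e he]

lemma tanh_nonneg {a : ℝ} (ha : 0 ≤ a) : 0 ≤ Real.tanh a := by
  rw [Real.tanh_eq_sinh_div_cosh]
  exact div_nonneg (Real.sinh_nonneg_iff.2 ha) (Real.cosh_pos a).le

/-- The configuration that is `-1` on `C` and `1` elsewhere: multiplying by it flips the spins
in `C`. -/
def flip (C : Set V) : V → ℤˣ := fun v => if v ∈ C then -1 else 1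

lemma spin_flip_of_mem {C : Set V} {x : V} (h : x ∈ C) : spin x (flip C) = -1 := by
  simp [spin, flip, h]

lemma spin_flip_of_notMem {C : Set V} {x : V} (h : x ∉ C) : spin x (flip C) = 1 := by
  simp [spin, flip, h]

variable [Fintype V]

lemma sum_mul_left_eq (τ : V → ℤˣ) (f : (V → ℤˣ) → ℝ) : ∑ σ, f (τ * σ) = ∑ σ, f σ :=
  Equiv.sum_comp (Equiv.mulLeft τ) f

lemma sum_eq_zero_of_odd {f : (V → ℤˣ) → ℝ} (τ : V → ℤˣ) (h : ∀ σ, f (τ * σ) = -f σ) :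
    ∑ σ, f σ = 0 := by
  have := sum_mul_left_eq τ f
  simp only [h, Finset.sum_neg_distrib] at this
  linarith

/-- Nonnegative multiples of monomials in the spins. -/
def spinMonomials (V : Type) [Fintype V] : Submonoid ((V → ℤˣ) → ℝ) where
  carrier := {f | ∃ c : ℝ, 0 ≤ c ∧ ∃ n : V → ℕ, f = fun σ => c * ∏ x, spin x σ ^ n x}
  one_mem' := ⟨1, zero_le_one, 0, by ext; simp⟩
  mul_mem' := by
    rintro _ _ ⟨c, hc, n, rfl⟩ ⟨c', hc', n', rfl⟩
    refine ⟨c * c', mul_nonneg hc hc', n + n', ?_⟩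
    ext σ
    simp only [Pi.mul_apply, Pi.add_apply, pow_add, Finset.prod_mul_distrib]
    ring

/-- The polynomials in the spins with nonnegative coefficients. Such a function has a nonnegative
sum over all configurations, and the Boltzmann weight of a ferromagnet is one of them. -/
def ferro (V : Type) [Fintype V] : Subsemiring ((V → ℤˣ) → ℝ) :=
  (spinMonomials V).subsemiringClosure

lemma sum_nonneg_of_mem_ferro {f : (V → ℤˣ) → ℝ} (hf : f ∈ ferro V) : 0 ≤ ∑ σ, f σ := by
  rw [ferro, Submonoid.subsemiringClosure_mem] at hf
  induction hf using AddSubmonoid.closure_induction with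
  | mem f hf =>
    obtain ⟨c, hc, n, rfl⟩ := hf
    rw [← Finset.mul_sum]
    refine mul_nonneg hc ?_
    have := Fintype.prod_sum (fun (x : V) (s : ℤˣ) => ((s : ℤ) : ℝ) ^ n x)
    simp only [spin]
    rw [← this]
    refine Finset.prod_nonneg fun x _ => ?_
    rw [show (Finset.univ : Finset ℤˣ) = {1, -1} from rfl]
    rcases Nat.even_or_odd (n x) with h | h <;> simp [h.neg_one_pow]
  | zero => simp
  | add f g _ _ hf hg => simpa [Finset.sum_add_distrib] using add_nonneg hf hg

lemma const_mem_ferro {c : ℝ} (hc : 0 ≤ c) : (fun _ : V → ℤˣ => c) ∈ ferro V := by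
  rw [ferro, Submonoid.subsemiringClosure_mem]
  exact AddSubmonoid.subset_closure ⟨c, hc, 0, by ext; simp⟩

lemma spin_mem_ferro (x : V) : spin x ∈ ferro V := by
  rw [ferro, Submonoid.subsemiringClosure_mem]
  refine AddSubmonoid.subset_closure ⟨1, zero_le_one, Pi.single x 1, ?_⟩
  ext σ
  rw [Finset.prod_eq_single x] <;> simp +contextual

lemma bond_mem_ferro (e : Sym2 V) : bond e ∈ ferro V := by
  induction e using Sym2.ind with
  | _ x y => exact mul_mem (spin_mem_ferro x) (spin_mem_ferro y)

lemma exp_bond_mem_ferro {J : ℝ} (hJ : 0 ≤ J) (e : Sym2 V) :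
    (fun σ => Real.exp (J * bond e σ)) ∈ ferro V := by
  simp only [exp_bond_eq]
  exact add_mem (const_mem_ferro (Real.cosh_pos _).le)
    (mul_mem (const_mem_ferro (Real.sinh_nonneg_iff.2 hJ)) (bond_mem_ferro e))

lemma exp_bond_sub_one_mem_ferro {J : ℝ} (hJ : 0 ≤ J) (e : Sym2 V) :
    (fun σ => Real.exp (J * bond e σ) - 1) ∈ ferro V := by
  simp only [exp_bond_eq, add_sub_right_comm]
  exact add_mem (const_mem_ferro (sub_nonneg.2 (Real.one_le_cosh _)))
    (mul_mem (const_mem_ferro (Real.sinh_nonneg_iff.2 hJ)) (bond_mem_ferro e))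

/-! ### Correlations on a finite set of edges, and the Griffiths inequalities -/

/-- The two-point function of the model with edges in `E`. Vertices on no edge of `E` carry free
spins, so that models with different edges can live on the same set of vertices. -/
def corr (E : Finset (Sym2 V)) (J : Sym2 V → ℝ) (x y : V) : ℝ :=
  (∑ σ, spin x σ * spin y σ * weight E J σ) / ∑ σ, weight E J σ

lemma twoPoint_eq_corr (G : SimpleGraph V) (J : Sym2 V → ℝ) (x y : V) :
    twoPoint G J x y = corr G.edgeFinset J x y := by
  have h (σ : V → ℤˣ) : Real.exp (-hamiltonian G J σ) = weight G.edgeFinset J σ := by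
    rw [hamiltonian, neg_neg, Real.exp_sum]; rfl
  simp only [twoPoint, partitionFunction, spinIntegral, h]
  exact mul_div_mul_left _ _ (by positivity)

lemma sum_weight_pos (E : Finset (Sym2 V)) (J : Sym2 V → ℝ) : 0 < ∑ σ, weight E J σ :=
  Finset.sum_pos (fun σ _ => weight_pos E J σ) Finset.univ_nonempty

lemma weight_mem_ferro {J : Sym2 V → ℝ} (hJ : ∀ e, 0 ≤ J e) (E : Finset (Sym2 V)) :
    weight E J ∈ ferro V := by
  rw [show weight E J = ∏ e ∈ E, fun σ => Real.exp (J e * bond e σ) by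
    ext σ; simp [weight]]
  exact prod_mem fun e _ => exp_bond_mem_ferro (hJ e) e

lemma corr_congr {E : Finset (Sym2 V)} {J J' : Sym2 V → ℝ} (h : ∀ e ∈ E, J e = J' e) :
    corr E J = corr E J' := by
  ext x y
  rw [corr, corr, weight_congr h]

lemma corr_self (E : Finset (Sym2 V)) (J : Sym2 V → ℝ) (x : V) : corr E J x x = 1 := by
  simp only [corr, spin_mul_self, one_mul]
  exact div_self (sum_weight_pos E J).ne'

/-- The first Griffiths inequality. -/
lemma corr_nonneg {J : Sym2 V → ℝ} (hJ : ∀ e, 0 ≤ J e) (E : Finset (Sym2 V)) (x y : V) :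
    0 ≤ corr E J x y :=
  div_nonneg (sum_nonneg_of_mem_ferro
    (mul_mem (mul_mem (spin_mem_ferro x) (spin_mem_ferro y)) (weight_mem_ferro hJ E)))
    (sum_weight_pos E J).le

/-- The duplication trick: in a product of two sums over configurations, the second configuration
is written as the first one times a relative configuration `τ`. -/
lemma sum_mul_sum_eq_duplicated (f g : (V → ℤˣ) → ℝ) :
    (∑ σ, f σ) * ∑ σ, g σ = ∑ τ, ∑ σ, f σ * g (σ * τ) := by
  rw [Finset.sum_mul_sum, Finset.sum_comm (f := fun τ σ => f σ * g (σ * τ))]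
  refine Finset.sum_congr rfl fun σ _ => ?_
  exact (sum_mul_left_eq σ fun τ => f σ * g τ).symm

/-- The second Griffiths inequality, for the addition of edges: given the relative configuration
`τ`, the first copy is a ferromagnet with the couplings `J e * (1 + bond e τ)` on `E₁`. -/
lemma corr_mono {J : Sym2 V → ℝ} (hJ : ∀ e, 0 ≤ J e) {E₁ E : Finset (Sym2 V)} (hE : E₁ ⊆ E)
    (x y : V) : corr E₁ J x y ≤ corr E J x y := by
  rw [corr, corr, div_le_div_iff₀ (sum_weight_pos _ _) (sum_weight_pos _ _), mul_comm,
    sum_mul_sum_eq_duplicated, sum_mul_sum_eq_duplicated, ← sub_nonneg, ← Finset.sum_sub_distrib]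
  refine Finset.sum_nonneg fun τ _ => ?_
  have hτ : 0 ≤ 1 - bond s(x, y) τ := by rcases bond_eq_or s(x, y) τ with h | h <;> simp [h]
  have hJτ (e : Sym2 V) : 0 ≤ J e * (1 + bond e τ) :=
    mul_nonneg (hJ e) (by rcases bond_eq_or e τ with h | h <;> simp [h])
  have key := sum_nonneg_of_mem_ferro (mul_mem (const_mem_ferro hτ)
    (mul_mem (bond_mem_ferro s(x, y)) (mul_mem (weight_mem_ferro hJ (E \ E₁))
      (weight_mem_ferro hJτ E₁))))
  rw [← Finset.sum_sub_distrib]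
  refine key.trans_eq (Finset.sum_congr rfl fun σ _ => ?_)
  have h1 : weight E₁ (fun e => J e * (1 + bond e τ)) σ = weight E₁ J σ * weight E₁ J (σ * τ) := by
    simp only [weight, ← Finset.prod_mul_distrib, ← Real.exp_add, bond_mul]
    exact Finset.prod_congr rfl fun e _ => by ring_nf
  simp only [Pi.mul_apply, h1, ← weight_mul_weight_sdiff hE J σ, bond_mk, spin_mul]
  ring

end SpinSystem

section SimonLieb

open scoped Classical

variable {V : Type}

/-! ### The Simon–Lieb inequality -/

/-- With `P = ∏ (1 + a e)` and `M = ∏ (1 - a e)`, the even and odd parts `P + M` and `P - M` have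
nonnegative coefficients, and each odd monomial `∏_{e ∈ B} a e` of `P - M` is dominated by the
`#B ≥ 1` ways of obtaining it as `a e` times an even monomial. -/
lemma even_odd_parts_mem {ι R : Type*} [CommRing R] (K : Subsemiring R) (a : ι → R)
    (ha : ∀ e, a e ∈ K) (D : Finset ι) :
    (∏ e ∈ D, (1 + a e) + ∏ e ∈ D, (1 - a e) ∈ K ∧
      ∏ e ∈ D, (1 + a e) - ∏ e ∈ D, (1 - a e) ∈ K) ∧
    (∑ e ∈ D, a e) * (∏ e ∈ D, (1 + a e) + ∏ e ∈ D, (1 - a e)) -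
      (∏ e ∈ D, (1 + a e) - ∏ e ∈ D, (1 - a e)) ∈ K := by
  induction D using Finset.induction_on with
  | empty => simp [one_add_one_eq_two]
  | insert e D he ih =>
    simp only [Finset.prod_insert he, Finset.sum_insert he]
    have hQ : ∑ e ∈ D, a e ∈ K := sum_mem fun e _ => ha e
    generalize ∏ e ∈ D, (1 + a e) = P at *
    generalize ∏ e ∈ D, (1 - a e) = M at *
    generalize ∑ e ∈ D, a e = Q at *
    obtain ⟨⟨hs, hd⟩, hq⟩ := ih
    refine ⟨⟨?_, ?_⟩, ?_⟩
    · convert add_mem hs (mul_mem (ha e) hd) using 1; ring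
    · convert add_mem hd (mul_mem (ha e) hs) using 1; ring
    · convert add_mem hq (add_mem (mul_mem (mul_mem hQ (ha e)) hd)
        (mul_mem (mul_mem (ha e) (ha e)) hd)) using 1
      ring

/-- The set of vertices joined to `x` by a path of edges in `ω`. -/
def cluster (ω : Finset (Sym2 V)) (x : V) : Set V :=
  {y | Relation.ReflTransGen (fun a b => s(a, b) ∈ ω) x y}

lemma mem_cluster_self (ω : Finset (Sym2 V)) (x : V) : x ∈ cluster ω x :=
  Relation.ReflTransGen.refl

lemma bond_flip_cluster {ω : Finset (Sym2 V)} {x : V} {e : Sym2 V} (he : e ∈ ω) :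
    bond e (flip (cluster ω x)) = 1 := by
  induction e using Sym2.ind with
  | _ a b =>
    have h : a ∈ cluster ω x ↔ b ∈ cluster ω x :=
      ⟨fun h => Relation.ReflTransGen.tail h he,
        fun h => Relation.ReflTransGen.tail h (by rwa [Sym2.eq_swap])⟩
    by_cases hb : b ∈ cluster ω x
    · simp [bond_mk, spin_flip_of_mem hb, spin_flip_of_mem (h.2 hb)]
    · simp [bond_mk, spin_flip_of_notMem hb, spin_flip_of_notMem (mt h.1 hb)]

/-- The indicator function of the event that `τ` is constant on the clusters of `ω`. -/
def agree (ω : Finset (Sym2 V)) (τ : V → ℤˣ) : ℝ := ∏ e ∈ ω, (1 + bond e τ) / 2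

lemma agree_nonneg (ω : Finset (Sym2 V)) (τ : V → ℤˣ) : 0 ≤ agree ω τ :=
  Finset.prod_nonneg fun e _ => by rcases bond_eq_or e τ with h | h <;> simp [h]

lemma agree_mul_bond {ω : Finset (Sym2 V)} {e : Sym2 V} (he : e ∈ ω) (τ : V → ℤˣ) :
    agree ω τ * bond e τ = agree ω τ := by
  rw [agree, ← Finset.mul_prod_erase _ _ he]
  rcases bond_eq_or e τ with h | h <;> simp [h]

lemma agree_mul_spin {ω : Finset (Sym2 V)} {x u : V} (hu : u ∈ cluster ω x) (τ : V → ℤˣ) :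
    agree ω τ * (spin x τ * spin u τ) = agree ω τ := by
  induction hu with
  | refl => rw [spin_mul_self, mul_one]
  | @tail a b _ hab ih =>
    have h := agree_mul_bond hab τ
    rw [bond_mk] at h
    calc _ = agree ω τ * (spin x τ * spin a τ) * (spin a τ * spin b τ) := by
          linear_combination (-agree ω τ * spin x τ * spin b τ) * spin_mul_self a τ
      _ = _ := by rw [ih, h]

lemma agree_flip_mul (ω : Finset (Sym2 V)) (x : V) (τ : V → ℤˣ) :
    agree ω (flip (cluster ω x) * τ) = agree ω τ :=
  Finset.prod_congr rfl fun e he => by rw [bond_mul, bond_flip_cluster he, one_mul]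

/-- The Edwards–Sokal type expansion of the duplicated weight over subsets `ω` of the edges that
both copies share. -/
lemma weight_mul_weight_eq_sum {E₁ E : Finset (Sym2 V)} (hE : E₁ ⊆ E) (J : Sym2 V → ℝ)
    (σ τ : V → ℤˣ) :
    weight E J σ * weight E₁ J (σ * τ) = ∑ ω ∈ E₁.powerset,
      agree ω τ * ((∏ e ∈ ω, (Real.exp (2 * J e * bond e σ) - 1)) * weight (E \ E₁) J σ) := by
  have h (e : Sym2 V) : Real.exp (J e * bond e σ) * Real.exp (J e * bond e (σ * τ)) =
      1 + (1 + bond e τ) / 2 * (Real.exp (2 * J e * bond e σ) - 1) := by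
    rw [← Real.exp_add, bond_mul]
    rcases bond_eq_or e τ with h | h <;> simp [h]
    ring_nf
  rw [← weight_mul_weight_sdiff hE, mul_assoc, weight, weight, weight, ← Finset.prod_mul_distrib]
  simp only [h, Finset.prod_one_add, agree, Finset.prod_mul_distrib, Finset.mul_sum]
  exact Finset.sum_congr rfl fun ω _ => by ring

variable [Fintype V]

/-- Summed over the relative configuration, the correlation of the spins at `x` and `u` becomes
the indicator of the event that `ω` joins `x` to `u`. -/
lemma sum_agree_mul_spin (ω : Finset (Sym2 V)) (x u : V) :
    ∑ τ, agree ω τ * (spin x τ * spin u τ) =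
      (∑ τ, agree ω τ) * if u ∈ cluster ω x then 1 else 0 := by
  split_ifs with hu
  · rw [mul_one]
    exact Finset.sum_congr rfl fun τ _ => agree_mul_spin hu τ
  · rw [mul_zero]
    refine sum_eq_zero_of_odd (flip (cluster ω x)) fun τ => ?_
    rw [agree_flip_mul, spin_mul, spin_mul, spin_flip_of_mem (mem_cluster_self ω x),
      spin_flip_of_notMem hu]
    ring

/-- The core of the Simon–Lieb inequality. A function that is odd under the flip of the spins in
`C` sees only the odd part of the weight of the edges that leave `C`, hence at least one such
edge. -/
lemma sum_mul_weight_le_of_odd {J : Sym2 V → ℝ} (hJ : ∀ e, 0 ≤ J e) (E : Finset (Sym2 V))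
    (C : Set V) {f : (V → ℤˣ) → ℝ} (hf : f ∈ ferro V) (hodd : ∀ σ, f (flip C * σ) = -f σ) :
    ∑ σ, f σ * weight E J σ ≤
      ∑ u, ∑ v, if u ∈ C ∧ s(u, v) ∈ E then
        Real.tanh (J s(u, v)) * ∑ σ, f σ * weight E J σ * bond s(u, v) σ else 0 := by
  set D := E.filter fun e => bond e (flip C) = -1 with hD
  have hDE : D ⊆ E := Finset.filter_subset _ _
  set a : Sym2 V → (V → ℤˣ) → ℝ := fun e σ => Real.tanh (J e) * bond e σ with ha
  have htanh (e : Sym2 V) : 0 ≤ Real.tanh (J e) := tanh_nonneg (hJ e)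
  have ha_mem (e : Sym2 V) : a e ∈ ferro V :=
    mul_mem (const_mem_ferro (htanh e)) (bond_mem_ferro e)
  set c : ℝ := ∏ e ∈ D, Real.cosh (J e) with hc
  have hc0 : 0 ≤ c := Finset.prod_nonneg fun e _ => (Real.cosh_pos _).le
  set P := ∏ e ∈ D, (1 + a e) with hP
  set M := ∏ e ∈ D, (1 - a e) with hM
  set Q := ∑ e ∈ D, a e with hQ
  obtain ⟨-, hPM⟩ := even_odd_parts_mem (ferro V) a ha_mem D
  -- the weight of the edges cut by the flip is `c * P`
  have hwD (σ : V → ℤˣ) : weight D J σ = c * P σ := by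
    simp only [weight, hc, hP, Finset.prod_apply, ← Finset.prod_mul_distrib, exp_bond_eq]
    refine Finset.prod_congr rfl fun e _ => ?_
    simp only [ha, Pi.add_apply, Pi.one_apply, Real.tanh_eq_sinh_div_cosh]
    field_simp [(Real.cosh_pos (J e)).ne']
  set g : (V → ℤˣ) → ℝ := fun σ => f σ * weight (E \ D) J σ * c with hg
  have hg_mem : g ∈ ferro V :=
    mul_mem (mul_mem hf (weight_mem_ferro hJ _)) (const_mem_ferro hc0)
  have hw (σ : V → ℤˣ) : f σ * weight E J σ = g σ * P σ := by
    rw [← weight_mul_weight_sdiff hDE, hwD, hg]; ring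
  have hDflip (e : Sym2 V) (he : e ∈ D) (σ : V → ℤˣ) : a e (flip C * σ) = -a e σ := by
    simp only [ha, bond_mul, (Finset.mem_filter.1 he).2]; ring
  have hg_odd (σ : V → ℤˣ) : g (flip C * σ) = -g σ := by
    have : weight (E \ D) J (flip C * σ) = weight (E \ D) J σ := by
      refine Finset.prod_congr rfl fun e he => ?_
      have : bond e (flip C) = 1 := by
        rcases bond_eq_or e (flip C) with h | h
        · exact h
        · simp [hD, h] at he
      rw [bond_mul, this, one_mul]
    simp only [hg, this, hodd]; ring
  have hP_flip (σ : V → ℤˣ) : P (flip C * σ) = M σ := by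
    simp only [hP, hM, Finset.prod_apply]
    exact Finset.prod_congr rfl fun e he => by simp [hDflip e he, sub_eq_add_neg]
  have hQ_flip (σ : V → ℤˣ) : Q (flip C * σ) = -Q σ := by
    simp only [hQ, Finset.sum_apply, ← Finset.sum_neg_distrib]
    exact Finset.sum_congr rfl fun e he => hDflip e he σ
  have h1 : ∑ σ, g σ * P σ = -∑ σ, g σ * M σ := by
    rw [← sum_mul_left_eq (flip C)]
    simp [hg_odd, hP_flip]
  have h2 : ∑ σ, g σ * P σ * Q σ = ∑ σ, g σ * M σ * Q σ := by
    rw [← sum_mul_left_eq (flip C)]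
    simp [hg_odd, hP_flip, hQ_flip]
  have hmain : ∑ σ, g σ * P σ ≤ ∑ σ, g σ * P σ * Q σ := by
    have key := sum_nonneg_of_mem_ferro (mul_mem hg_mem hPM)
    have : ∑ σ, (g * (Q * (P + M) - (P - M))) σ = ∑ σ, g σ * P σ * Q σ + ∑ σ, g σ * M σ * Q σ -
        ∑ σ, g σ * P σ + ∑ σ, g σ * M σ := by
      rw [← Finset.sum_add_distrib, ← Finset.sum_sub_distrib, ← Finset.sum_add_distrib]
      refine Finset.sum_congr rfl fun σ _ => ?_
      simp only [Pi.mul_apply, Pi.add_apply, Pi.sub_apply]; ring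
    rw [this] at key
    linarith
  -- each edge of `D` has exactly one orientation that leaves `C`
  have hsum : ∑ e ∈ D, Real.tanh (J e) * ∑ σ, f σ * weight E J σ * bond e σ =
      ∑ p : V × V with p.1 ∈ C ∧ p.2 ∉ C ∧ s(p.1, p.2) ∈ E,
        Real.tanh (J s(p.1, p.2)) * ∑ σ, f σ * weight E J σ * bond s(p.1, p.2) σ := by
    symm
    refine Finset.sum_nbij (fun p => s(p.1, p.2)) ?_ ?_ ?_ fun _ _ => rfl
    · rintro ⟨u, v⟩ h
      simp only [Finset.mem_filter, Finset.mem_univ, true_and] at h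
      simp [hD, h.2.2, bond_mk, spin_flip_of_mem h.1, spin_flip_of_notMem h.2.1]
    · rintro ⟨u, v⟩ h ⟨u', v'⟩ h' heq
      simp only [Finset.coe_filter, Finset.mem_univ, true_and, Set.mem_ofPred_eq] at h h'
      rcases Sym2.eq_iff.1 heq with ⟨h3, h4⟩ | ⟨h3, h4⟩
      · exact Prod.ext h3 h4
      · cases h3; exact absurd h.1 h'.2.1
    · intro e he
      simp only [hD, Finset.coe_filter, Set.mem_ofPred_eq] at he
      induction e using Sym2.ind with
      | _ u v =>
        by_cases hu : u ∈ C <;> by_cases hv : v ∈ C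
        · norm_num [bond_mk, spin_flip_of_mem hu, spin_flip_of_mem hv] at he
        · exact ⟨(u, v), by simp [hu, hv, he.1], rfl⟩
        · exact ⟨(v, u), by simp [hu, hv, Sym2.eq_swap, he.1], Sym2.eq_swap⟩
        · norm_num [bond_mk, spin_flip_of_notMem hu, spin_flip_of_notMem hv] at he
  calc ∑ σ, f σ * weight E J σ ≤ ∑ σ, g σ * P σ * Q σ := by simpa only [hw] using hmain
    _ = ∑ e ∈ D, Real.tanh (J e) * ∑ σ, f σ * weight E J σ * bond e σ := by
      simp only [hw, hQ, Finset.sum_apply, Finset.mul_sum]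
      rw [Finset.sum_comm]
      exact Finset.sum_congr rfl fun e _ => Finset.sum_congr rfl fun σ _ => by
        simp only [ha]; ring
    _ ≤ _ := by
      rw [hsum, ← Fintype.sum_prod_type'
        (f := fun u v => if u ∈ C ∧ s(u, v) ∈ E then Real.tanh (J s(u, v)) *
          ∑ σ, f σ * weight E J σ * bond s(u, v) σ else 0), ← Finset.sum_filter]
      refine Finset.sum_le_sum_of_subset_of_nonneg ?_ ?_
      · intro p hp
        simp only [Finset.mem_filter, Finset.mem_univ, true_and] at hp ⊢
        exact ⟨hp.1, hp.2.2⟩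
      · exact fun p _ _ => mul_nonneg (htanh _) (sum_nonneg_of_mem_ferro
          (mul_mem (mul_mem hf (weight_mem_ferro hJ E)) (bond_mem_ferro _)))

/-- The Simon–Lieb inequality with the factor `tanh J`: to correlate with `y`, the spin at `x`
either stays within the edges of `E₁`, or leaves them for a first time through an oriented edge
`(u, v)`. -/
theorem corr_le_simon_lieb {J : Sym2 V → ℝ} (hJ : ∀ e, 0 ≤ J e) {E₁ E : Finset (Sym2 V)}
    (hE : E₁ ⊆ E) (x y : V) :
    corr E J x y ≤ corr E₁ J x y + ∑ u, ∑ v, if s(u, v) ∈ E \ E₁ then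
      Real.tanh (J s(u, v)) * (corr E₁ J x u * corr E J v y) else 0 := by
  have hZ := sum_weight_pos E J
  have hZ₁ := sum_weight_pos E₁ J
  set Z := ∑ σ, weight E J σ with hZdef
  set Z₁ := ∑ σ, weight E₁ J σ with hZ₁def
  set b : Finset (Sym2 V) → (V → ℤˣ) → ℝ := fun ω σ =>
    (∏ e ∈ ω, (Real.exp (2 * J e * bond e σ) - 1)) * weight (E \ E₁) J σ with hb
  set k : Finset (Sym2 V) → ℝ := fun ω => ∑ τ, agree ω τ with hk
  have hk0 (ω : Finset (Sym2 V)) : 0 ≤ k ω := Finset.sum_nonneg fun τ _ => agree_nonneg ω τ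
  -- a product of correlations, expanded over the clusters of the shared edges
  have expand (u v : V) : corr E₁ J x u * corr E J v y * (Z * Z₁) =
      ∑ ω ∈ E₁.powerset, k ω * if u ∈ cluster ω x then
        ∑ σ, spin x σ * spin u σ * (spin v σ * spin y σ) * b ω σ else 0 := by
    have h1 : corr E₁ J x u * corr E J v y * (Z * Z₁) =
        (∑ σ, spin v σ * spin y σ * weight E J σ) *
          ∑ σ, spin x σ * spin u σ * weight E₁ J σ := by
      rw [corr, corr, ← hZdef, ← hZ₁def]; field_simp
    rw [h1, sum_mul_sum_eq_duplicated]
    have h2 (τ σ : V → ℤˣ) : spin v σ * spin y σ * weight E J σ *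
        (spin x (σ * τ) * spin u (σ * τ) * weight E₁ J (σ * τ)) =
        ∑ ω ∈ E₁.powerset, agree ω τ * (spin x τ * spin u τ) *
          (spin x σ * spin u σ * (spin v σ * spin y σ) * b ω σ) := by
      calc _ = spin x τ * spin u τ * (spin x σ * spin u σ * (spin v σ * spin y σ)) *
            (weight E J σ * weight E₁ J (σ * τ)) := by rw [spin_mul, spin_mul]; ring
        _ = _ := by
          rw [weight_mul_weight_eq_sum hE, Finset.mul_sum]
          exact Finset.sum_congr rfl fun ω _ => by simp only [hb]; ring
    simp only [h2]
    rw [Finset.sum_congr rfl fun τ _ => Finset.sum_comm, Finset.sum_comm]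
    refine Finset.sum_congr rfl fun ω _ => ?_
    simp only [← Finset.mul_sum]
    rw [← Finset.sum_mul, sum_agree_mul_spin]
    split_ifs <;> simp [hk]
  have expand₀ : corr E J x y * (Z * Z₁) =
      ∑ ω ∈ E₁.powerset, k ω * ∑ σ, spin x σ * spin y σ * b ω σ := by
    have := expand x x
    rw [corr_self, one_mul] at this
    rw [this]
    exact Finset.sum_congr rfl fun ω _ => by simp [mem_cluster_self, spin_mul_self]
  have expand₁ : corr E₁ J x y * (Z * Z₁) = ∑ ω ∈ E₁.powerset, k ω *
      if y ∈ cluster ω x then ∑ σ, spin x σ * spin y σ * b ω σ else 0 := by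
    have := expand y y
    rw [corr_self, mul_one] at this
    rw [this]
    exact Finset.sum_congr rfl fun ω _ => by simp [spin_mul_self]
  refine le_of_mul_le_mul_right ?_ (mul_pos hZ hZ₁)
  -- the same expansion for the sum over the oriented edges, the sum over `ω` moved outside
  have hsum (T : V → V → Finset (Sym2 V) → ℝ) : (∑ u, ∑ v, if s(u, v) ∈ E \ E₁ then
      Real.tanh (J s(u, v)) * ∑ ω ∈ E₁.powerset, k ω * (if u ∈ cluster ω x then T u v ω else 0)
        else 0) =
      ∑ ω ∈ E₁.powerset, k ω * ∑ u, ∑ v, if u ∈ cluster ω x ∧ s(u, v) ∈ E \ E₁ then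
        Real.tanh (J s(u, v)) * T u v ω else 0 := by
    simp only [Finset.mul_sum]
    rw [Finset.sum_comm (s := E₁.powerset)]
    refine Finset.sum_congr rfl fun u _ => ?_
    rw [Finset.sum_comm (s := E₁.powerset)]
    refine Finset.sum_congr rfl fun v _ => ?_
    by_cases huv : s(u, v) ∈ E \ E₁
    · simp only [huv, if_true, and_true]
      exact Finset.sum_congr rfl fun ω _ => by split_ifs <;> ring
    · simp only [huv, if_false, and_false, mul_zero, Finset.sum_const_zero]
  simp only [add_mul, Finset.sum_mul, ite_mul, zero_mul, mul_assoc (Real.tanh _), expand]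
  rw [hsum, expand₀, expand₁, ← Finset.sum_add_distrib]
  refine Finset.sum_le_sum fun ω _ => ?_
  rw [← mul_add]
  refine mul_le_mul_of_nonneg_left ?_ (hk0 ω)
  set p : (V → ℤˣ) → ℝ := ∏ e ∈ ω, fun σ => Real.exp (2 * J e * bond e σ) - 1 with hp
  have hp_apply (σ : V → ℤˣ) : b ω σ = p σ * weight (E \ E₁) J σ := by
    simp [hb, hp, Finset.prod_apply]
  have hp_mem : p ∈ ferro V :=
    prod_mem fun e _ => exp_bond_sub_one_mem_ferro (mul_nonneg zero_le_two (hJ e)) e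
  have hf_mem : spin x * spin y * p ∈ ferro V :=
    mul_mem (mul_mem (spin_mem_ferro x) (spin_mem_ferro y)) hp_mem
  have hterm (u v : V) : ∑ σ, spin x σ * spin u σ * (spin v σ * spin y σ) * b ω σ =
      ∑ σ, (spin x * spin y * p) σ * weight (E \ E₁) J σ * bond s(u, v) σ :=
    Finset.sum_congr rfl fun σ _ => by simp only [hp_apply, bond_mk, Pi.mul_apply]; ring
  have hterm₀ : ∑ σ, spin x σ * spin y σ * b ω σ =
      ∑ σ, (spin x * spin y * p) σ * weight (E \ E₁) J σ :=
    Finset.sum_congr rfl fun σ _ => by simp only [hp_apply, Pi.mul_apply]; ring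
  simp only [hterm, hterm₀]
  split_ifs with hy
  · refine le_add_of_nonneg_right (Finset.sum_nonneg fun u _ => Finset.sum_nonneg fun v _ => ?_)
    split_ifs
    · exact mul_nonneg (tanh_nonneg (hJ _)) (sum_nonneg_of_mem_ferro
        (mul_mem (mul_mem hf_mem (weight_mem_ferro hJ _)) (bond_mem_ferro _)))
    · exact le_rfl
  · rw [zero_add]
    refine sum_mul_weight_le_of_odd hJ (E \ E₁) (cluster ω x) hf_mem fun σ => ?_
    have hp_flip : p (flip (cluster ω x) * σ) = p σ := by
      simp only [hp, Finset.prod_apply]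
      exact Finset.prod_congr rfl fun e he => by rw [bond_mul, bond_flip_cluster he, one_mul]
    simp only [Pi.mul_apply, hp_flip, spin_mul, spin_flip_of_mem (mem_cluster_self ω x),
      spin_flip_of_notMem hy]
    ring

/-! ### Embeddings of vertex sets -/

variable {W : Type}

/-- Spins are uncorrelated across a set that no edge leaves. -/
lemma corr_eq_zero_of_uncut {E : Finset (Sym2 V)} {C : Set V}
    (hE : ∀ e ∈ E, bond e (flip C) = 1) (J : Sym2 V → ℝ) {x y : V} (hx : x ∈ C) (hy : y ∉ C) :
    corr E J x y = 0 := by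
  rw [corr, sum_eq_zero_of_odd (flip C), zero_div]
  intro σ
  have : weight E J (flip C * σ) = weight E J σ :=
    Finset.prod_congr rfl fun e he => by rw [bond_mul, hE e he, one_mul]
  rw [this, spin_mul, spin_mul, spin_flip_of_mem hx, spin_flip_of_notMem hy]
  ring

lemma corr_map_eq_zero (ι : W ↪ V) (E : Finset (Sym2 W)) (J : Sym2 V → ℝ) (x : W) {y : V}
    (hy : y ∉ Set.range ι) : corr (E.map ι.sym2Map) J (ι x) y = 0 := by
  refine corr_eq_zero_of_uncut (C := Set.range ι) ?_ J ⟨x, rfl⟩ hy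
  intro e he
  obtain ⟨e, -, rfl⟩ := Finset.mem_map.1 he
  induction e using Sym2.ind with
  | _ a b => simp [bond_mk, spin_flip_of_mem]

variable [Fintype W]

/-- A function of the restricted configuration has the same average on either vertex set. -/
lemma card_mul_sum_comp (ι : W ↪ V) (f : (W → ℤˣ) → ℝ) :
    (Fintype.card (W → ℤˣ) : ℝ) * ∑ σ : V → ℤˣ, f (σ ∘ ι) =
      (Fintype.card (V → ℤˣ) : ℝ) * ∑ τ, f τ := by
  -- average over multiplication of `σ` by the extension of `τ`
  have h (τ : W → ℤˣ) : ∑ σ : V → ℤˣ, f (σ ∘ ι) = ∑ σ : V → ℤˣ, f (σ ∘ ι * τ) := by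
    rw [← sum_mul_left_eq (Function.extend ι τ 1)]
    refine Finset.sum_congr rfl fun σ _ => congrArg f ?_
    ext w
    simp [ι.injective.extend_apply, mul_comm]
  calc _ = ∑ τ : W → ℤˣ, ∑ σ : V → ℤˣ, f (σ ∘ ι * τ) := by
        simp only [← h, Finset.sum_const, Finset.card_univ, nsmul_eq_mul]
    _ = _ := by
        rw [Finset.sum_comm]
        simp only [sum_mul_left_eq, Finset.sum_const, Finset.card_univ, nsmul_eq_mul]

lemma corr_map (ι : W ↪ V) (E : Finset (Sym2 W)) (J : Sym2 V → ℝ) (x y : W) :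
    corr (E.map ι.sym2Map) J (ι x) (ι y) = corr E (fun e => J (e.map ι)) x y := by
  have hw (σ : V → ℤˣ) :
      weight (E.map ι.sym2Map) J σ = weight E (fun e => J (e.map ι)) (σ ∘ ι) := by
    rw [weight, Finset.prod_map]
    refine Finset.prod_congr rfl fun e _ => ?_
    induction e using Sym2.ind with
    | _ a b => rfl
  have h1 := card_mul_sum_comp ι (weight E fun e => J (e.map ι))
  have h2 := card_mul_sum_comp ι fun σ => spin x σ * spin y σ * weight E (fun e => J (e.map ι)) σ
  have hV : (Fintype.card (V → ℤˣ) : ℝ) ≠ 0 := Nat.cast_ne_zero.2 Fintype.card_ne_zero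
  have hW : (Fintype.card (W → ℤˣ) : ℝ) ≠ 0 := Nat.cast_ne_zero.2 Fintype.card_ne_zero
  simp only [corr, hw]
  rw [← mul_div_mul_left _ _ hW, h1]
  refine Eq.trans (congrArg (· / _) h2) ?_
  exact mul_div_mul_left _ _ hV

end SimonLieb

section Susceptibility

open scoped Classical

variable {V W : Type} [Fintype V] [Fintype W]

/-! ### Susceptibilities of finite graphs -/

lemma twoPoint_nonneg (G : SimpleGraph V) {J : Sym2 V → ℝ} (hJ : ∀ e, 0 ≤ J e) (x y : V) :
    0 ≤ twoPoint G J x y := by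
  rw [twoPoint_eq_corr]
  exact corr_nonneg hJ _ x y

lemma sum_twoPoint_le_finiteSusceptibility (G : SimpleGraph V) (J : Sym2 V → ℝ) (x : V) :
    ∑ y, twoPoint G J x y ≤ finiteSusceptibility G J :=
  le_ciSup (f := fun x => ∑ y, twoPoint G J x y) (Set.finite_range _).bddAbove x

lemma one_le_finiteSusceptibility [Nonempty V] (G : SimpleGraph V) {J : Sym2 V → ℝ}
    (hJ : ∀ e, 0 ≤ J e) : 1 ≤ finiteSusceptibility G J := by
  obtain ⟨x⟩ := ‹Nonempty V›
  refine le_trans ?_ (sum_twoPoint_le_finiteSusceptibility G J x)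
  calc 1 = twoPoint G J x x := by rw [twoPoint_eq_corr, corr_self]
    _ ≤ _ := Finset.single_le_sum (fun y _ => twoPoint_nonneg G hJ x y) (Finset.mem_univ x)

lemma finiteSusceptibility_congr {G : SimpleGraph V} {J J' : Sym2 V → ℝ}
    (h : ∀ x y, G.Adj x y → J s(x, y) = J' s(x, y)) :
    finiteSusceptibility G J = finiteSusceptibility G J' := by
  have : corr G.edgeFinset J = corr G.edgeFinset J' := by
    refine corr_congr fun e he => ?_
    induction e using Sym2.ind with
    | _ x y => exact h x y (by simpa using he)
  simp only [finiteSusceptibility, twoPoint_eq_corr, this]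

lemma edgeFinset_map_subset {H : SimpleGraph W} {G : SimpleGraph V} (ι : H ↪g G) :
    H.edgeFinset.map ι.toEmbedding.sym2Map ⊆ G.edgeFinset := by
  intro e he
  obtain ⟨e', he', rfl⟩ := Finset.mem_map.1 he
  clear he
  induction e' using Sym2.ind with
  | _ a b =>
    rw [SimpleGraph.mem_edgeFinset, SimpleGraph.mem_edgeSet] at he'
    exact SimpleGraph.mem_edgeFinset.2 (ι.map_adj_iff.2 he')

lemma sum_corr_map_mul (ι : W ↪ V) (E : Finset (Sym2 W)) (J : Sym2 V → ℝ) (a : W) (g : V → ℝ) :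
    ∑ u, corr (E.map ι.sym2Map) J (ι a) u * g u =
      ∑ b, corr E (fun e => J (e.map ι)) a b * g (ι b) := by
  simp only [← corr_map]
  rw [← Finset.sum_map Finset.univ ι fun u => corr (E.map ι.sym2Map) J (ι a) u * g u]
  refine (Finset.sum_subset (Finset.subset_univ _) fun u _ hu => ?_).symm
  rw [corr_map_eq_zero ι E J a (by simpa using hu), zero_mul]

/-- The susceptibility increases with the graph, by the second Griffiths inequality. -/
lemma finiteSusceptibility_mono [Nonempty W] {H : SimpleGraph W} {G : SimpleGraph V} (ι : H ↪g G)
    {J : Sym2 V → ℝ} (hJ : ∀ e, 0 ≤ J e) :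
    finiteSusceptibility H (fun e => J (e.map ι)) ≤ finiteSusceptibility G J := by
  refine ciSup_le fun a => ?_
  refine le_trans ?_ (sum_twoPoint_le_finiteSusceptibility G J (ι a))
  have h := sum_corr_map_mul ι.toEmbedding H.edgeFinset J a 1
  simp only [Pi.one_apply, mul_one] at h
  simp only [twoPoint_eq_corr]
  exact h.symm.trans_le (Finset.sum_le_sum fun u _ => corr_mono hJ (edgeFinset_map_subset ι) _ _)

/-- If every vertex of `G` lies in an induced copy of `H`, and `K` bounds the total `tanh J` of
the edges that leave such a copy at any of its vertices, then the Simon–Lieb inequality summed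
over the end point bounds the susceptibility of `G` in terms of itself. -/
lemma finiteSusceptibility_le_of_layers [Nonempty V] {H : SimpleGraph W} {G : SimpleGraph V}
    {J : Sym2 V → ℝ} (hJ : ∀ e, 0 ≤ J e) (J' : Sym2 W → ℝ) {K : ℝ} (hK : 0 ≤ K)
    (h : ∀ x : V, ∃ ι : H ↪g G, x ∈ Set.range ι ∧
      (∀ a b, H.Adj a b → J s(ι a, ι b) = J' s(a, b)) ∧
      ∀ a, ∀ L : Finset V, (∀ v ∈ L, G.Adj (ι a) v ∧ v ∉ Set.range ι) →
        ∑ v ∈ L, Real.tanh (J s(ι a, v)) ≤ K) :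
    finiteSusceptibility G J ≤ finiteSusceptibility H J' +
      finiteSusceptibility H J' * K * finiteSusceptibility G J := by
  set X := finiteSusceptibility G J
  have hX0 : 0 ≤ X := zero_le_one.trans (one_le_finiteSusceptibility G hJ)
  refine ciSup_le fun x => ?_
  obtain ⟨ι, ⟨a₀, rfl⟩, hJJ', hιK⟩ := h x
  have hc : finiteSusceptibility H J' = finiteSusceptibility H fun e => J (e.map ι) :=
    finiteSusceptibility_congr fun a b hab => (hJJ' a b hab).symm
  set c := finiteSusceptibility H J'
  set E := G.edgeFinset with hE
  set E₁ := H.edgeFinset.map ι.toEmbedding.sym2Map with hE₁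
  set F : W → ℝ := fun a => corr H.edgeFinset (fun e => J (e.map ι)) a₀ a with hF
  have hF0 (a : W) : 0 ≤ F a := corr_nonneg (fun e => hJ _) _ _ _
  have hFc : ∑ a, F a ≤ c := by
    rw [hc]
    simpa only [twoPoint_eq_corr] using sum_twoPoint_le_finiteSusceptibility H
      (fun e => J (e.map ι)) a₀
  have hXv (v : V) : ∑ y, corr E J v y ≤ X := by
    simpa only [twoPoint_eq_corr] using sum_twoPoint_le_finiteSusceptibility G J v
  have hleave (a : W) (v : V) (hv : s(ι a, v) ∈ E \ E₁) : G.Adj (ι a) v ∧ v ∉ Set.range ι := by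
    rw [Finset.mem_sdiff, hE, SimpleGraph.mem_edgeFinset, SimpleGraph.mem_edgeSet] at hv
    refine ⟨hv.1, ?_⟩
    rintro ⟨b, rfl⟩
    exact hv.2 (Finset.mem_map.2 ⟨s(a, b), by simpa using hv.1, rfl⟩)
  have hstep (a : W) : (∑ v, if s(ι a, v) ∈ E \ E₁ then
      Real.tanh (J s(ι a, v)) * ∑ y, corr E J v y else 0) ≤ K * X := by
    rw [← Finset.sum_filter]
    refine le_trans ?_ (mul_le_mul_of_nonneg_right
      (hιK a {v | s(ι a, v) ∈ E \ E₁} fun v hv => hleave a v (Finset.mem_filter.1 hv).2) hX0)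
    rw [Finset.sum_mul]
    exact Finset.sum_le_sum fun v _ => mul_le_mul_of_nonneg_left (hXv v) (tanh_nonneg (hJ _))
  have h1 : ∑ y, corr E₁ J (ι a₀) y = ∑ a, F a := by
    have := sum_corr_map_mul ι.toEmbedding H.edgeFinset J a₀ 1
    simp only [Pi.one_apply, mul_one] at this
    exact this
  calc ∑ y, twoPoint G J (ι a₀) y
      ≤ ∑ y, (corr E₁ J (ι a₀) y + ∑ u, ∑ v, if s(u, v) ∈ E \ E₁ then
          Real.tanh (J s(u, v)) * (corr E₁ J (ι a₀) u * corr E J v y) else 0) := by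
        simp only [twoPoint_eq_corr]
        exact Finset.sum_le_sum fun y _ => corr_le_simon_lieb hJ (edgeFinset_map_subset ι) _ _
    _ = ∑ a, F a + ∑ u, corr E₁ J (ι a₀) u * ∑ v, if s(u, v) ∈ E \ E₁ then
          Real.tanh (J s(u, v)) * ∑ y, corr E J v y else 0 := by
        rw [Finset.sum_add_distrib, h1, Finset.sum_comm]
        refine congrArg _ (Finset.sum_congr rfl fun u _ => ?_)
        rw [Finset.sum_comm, Finset.mul_sum]
        refine Finset.sum_congr rfl fun v _ => ?_
        split_ifs
        · simp only [Finset.mul_sum]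
          exact Finset.sum_congr rfl fun y _ => by ring
        · simp
    _ = ∑ a, F a + ∑ a, F a * ∑ v, if s(ι a, v) ∈ E \ E₁ then
          Real.tanh (J s(ι a, v)) * ∑ y, corr E J v y else 0 :=
        congrArg _ (sum_corr_map_mul ι.toEmbedding H.edgeFinset J a₀ _)
    _ ≤ ∑ a, F a + ∑ a, F a * (K * X) := by
        gcongr with a
        · exact hF0 a
        · exact hstep a
    _ ≤ c + c * K * X := by
        rw [← Finset.sum_mul, mul_assoc]
        exact add_le_add hFc (mul_le_mul_of_nonneg_right hFc (mul_nonneg hK hX0))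

end Susceptibility

section Lattice

/-! ### Boxes in the lattices -/

lemma susceptibilityIn_mono {V : Type} (G : SimpleGraph V) {J : Sym2 V → ℝ} (hJ : ∀ e, 0 ≤ J e)
    {Λ Λ' : Finset V} (h : Λ ⊆ Λ') (hΛ : Λ.Nonempty) :
    susceptibilityIn G J Λ ≤ susceptibilityIn G J Λ' := by
  have : Nonempty Λ := hΛ.to_subtype
  let ι : (G.induce (Λ : Set V)) ↪g (G.induce (Λ' : Set V)) :=
    SimpleGraph.induceHomOfLE G (Finset.coe_subset.2 h)
  have key := finiteSusceptibility_mono (V := Λ') (W := Λ) ι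
    (J := fun e => J (e.map Subtype.val)) fun e => hJ _
  simp only [Sym2.map_map] at key
  exact key

lemma box_mono (n : ℕ) : Monotone (box n) := fun N M h =>
  Finset.Icc_subset_Icc (fun _ => by simpa using h) (fun _ => by simpa using h)

lemma box_nonempty (n N : ℕ) : (box n N).Nonempty :=
  Finset.nonempty_Icc.2 fun _ => by simp

lemma coupling_nonneg (d s : ℕ) {Jd Js : ℝ} (hJd : 0 ≤ Jd) (hJs : 0 ≤ Js)
    (e : Sym2 ((Fin d → ℤ) × (Fin s → ℤ))) : 0 ≤ coupling d s Jd Js e := by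
  unfold coupling
  split_ifs <;> assumption

lemma chiPlanarBox_mono (d : ℕ) {Jd : ℝ} (hJd : 0 ≤ Jd) : Monotone (chiPlanarBox d Jd) :=
  fun _ _ h => susceptibilityIn_mono _ (fun _ => hJd) (box_mono d h) (box_nonempty _ _)

lemma chiFullBox_mono (d s : ℕ) {Jd Js : ℝ} (hJd : 0 ≤ Jd) (hJs : 0 ≤ Js) :
    Monotone (chiFullBox d s Jd Js) :=
  fun _ _ h => susceptibilityIn_mono _ (coupling_nonneg d s hJd hJs)
    (Finset.product_subset_product (box_mono d h) (box_mono s h))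
    ((box_nonempty _ _).product (box_nonempty _ _))

lemma eq_add_single_of_latticeGraph_adj {n : ℕ} {t t' : Fin n → ℤ} (h : (latticeGraph n).Adj t t') :
    ∃ i, ∃ ε ∈ ({1, -1} : Finset ℤ), t + Pi.single i ε = t' := by
  change ∑ i, |t i - t' i| = 1 at h
  obtain ⟨i, -, hi⟩ : ∃ i ∈ Finset.univ, |t i - t' i| ≠ 0 :=
    Finset.exists_ne_zero_of_sum_ne_zero (by omega)
  rw [← Finset.add_sum_erase _ _ (Finset.mem_univ i)] at h
  have h0 : 0 ≤ ∑ j ∈ Finset.univ.erase i, |t j - t' j| := Finset.sum_nonneg fun j _ => abs_nonneg _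
  have hi' : 0 < |t i - t' i| := lt_of_le_of_ne (abs_nonneg _) hi.symm
  have hrest := (Finset.sum_eq_zero_iff_of_nonneg fun j _ => abs_nonneg _).1
    (show ∑ j ∈ Finset.univ.erase i, |t j - t' j| = 0 by omega)
  refine ⟨i, t' i - t i, ?_, ?_⟩
  · have : |t i - t' i| = 1 := by omega
    rcases (abs_eq zero_le_one).1 this with h | h <;> simp <;> omega
  · ext j
    by_cases hj : j = i
    · subst hj; simp
    · have := abs_eq_zero.1 (hrest j (by simp [hj]))
      simp [hj]; omega

lemma card_le_of_latticeGraph_adj {n : ℕ} (t : Fin n → ℤ) (A : Finset (Fin n → ℤ))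
    (hA : ∀ t' ∈ A, (latticeGraph n).Adj t t') : A.card ≤ 2 * n := by
  have : A ⊆ (Finset.univ ×ˢ {1, -1}).image fun p : Fin n × ℤ => t + Pi.single p.1 p.2 := by
    intro t' ht'
    obtain ⟨i, ε, hε, h⟩ := eq_add_single_of_latticeGraph_adj (hA t' ht')
    exact Finset.mem_image.2 ⟨(i, ε), Finset.mem_product.2 ⟨Finset.mem_univ _, hε⟩, h⟩
  refine (Finset.card_le_card this).trans (Finset.card_image_le.trans ?_)
  simp [mul_comm]

/-- The embedding of `A` as the horizontal layer of `A ×ˢ B` at height `t ∈ B`. -/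
def layerEmbedding {d s : ℕ} (A : Finset (Fin d → ℤ)) {B : Finset (Fin s → ℤ)} {t : Fin s → ℤ}
    (ht : t ∈ B) : (latticeGraph d).induce (A : Set (Fin d → ℤ)) ↪g
      (productGraph d s).induce ((A ×ˢ B : Finset _) : Set ((Fin d → ℤ) × (Fin s → ℤ))) where
  toFun a := ⟨(a.1, t), Finset.mem_coe.2 (Finset.mem_product.2 ⟨a.2, ht⟩)⟩
  inj' a b h := Subtype.ext (congrArg (fun v => v.1.1) h)
  map_rel_iff' {a b} := by
    change (productGraph d s).Adj (a.1, t) (b.1, t) ↔ (latticeGraph d).Adj a.1 b.1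
    simp [productGraph, SimpleGraph.boxProd_adj]

open scoped Classical in
/-- At most `2s` vertical edges leave a horizontal layer at each of its vertices. -/
lemma susceptibilityIn_product_le {d s : ℕ} {Jd Js : ℝ} (hJd : 0 ≤ Jd) (hJs : 0 ≤ Js)
    {A : Finset (Fin d → ℤ)} {B : Finset (Fin s → ℤ)} (hA : A.Nonempty) (hB : B.Nonempty) :
    susceptibilityIn (productGraph d s) (coupling d s Jd Js) (A ×ˢ B) ≤
      susceptibilityIn (latticeGraph d) (fun _ => Jd) A +
      susceptibilityIn (latticeGraph d) (fun _ => Jd) A * (2 * s * Real.tanh Js) *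
        susceptibilityIn (productGraph d s) (coupling d s Jd Js) (A ×ˢ B) := by
  have : Nonempty ↥(A ×ˢ B) := (hA.product hB).to_subtype
  refine finiteSusceptibility_le_of_layers (V := ↥(A ×ˢ B)) (W := ↥A)
    (fun e => coupling_nonneg d s hJd hJs _) _
    (mul_nonneg (by positivity) (tanh_nonneg hJs)) ?_
  rintro ⟨⟨u, t⟩, hx⟩
  obtain ⟨hu, ht⟩ := Finset.mem_product.1 hx
  refine ⟨layerEmbedding A ht, ⟨⟨u, hu⟩, rfl⟩, fun a b hab => ?_, fun a L hL => ?_⟩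
  · have hab' : (latticeGraph d).Adj a.1 b.1 := hab
    have : ((latticeGraph d).boxProd (⊥ : SimpleGraph (Fin s → ℤ))).Adj (a.1, t) (b.1, t) :=
      SimpleGraph.boxProd_adj.2 (Or.inl ⟨hab', rfl⟩)
    exact if_pos this
  · have hvert (v : ↥(A ×ˢ B)) (hv : v ∈ L) : (latticeGraph s).Adj t v.1.2 ∧ a.1 = v.1.1 := by
      obtain ⟨hadj, hv⟩ := hL v hv
      rcases SimpleGraph.boxProd_adj.1 hadj with h | h
      · refine absurd ⟨⟨v.1.1, (Finset.mem_product.1 v.2).1⟩, ?_⟩ hv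
        exact Subtype.ext (Prod.ext rfl h.2)
      · exact h
    have hcard : L.card ≤ 2 * s := by
      rw [← Finset.card_image_of_injOn (f := fun v : ↥(A ×ˢ B) => v.1.2) (s := L)]
      · refine card_le_of_latticeGraph_adj t _ fun t' ht' => ?_
        obtain ⟨v, hv, rfl⟩ := Finset.mem_image.1 ht'
        exact (hvert v hv).1
      · intro v hv w hw h
        exact Subtype.ext (Prod.ext ((hvert v hv).2.symm.trans (hvert w hw).2) h)
    have hval (v : ↥(A ×ˢ B)) (hv : v ∈ L) : coupling d s Jd Js s((a.1, t), v.1) = Js := by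
      refine if_neg fun h => ?_
      rcases SimpleGraph.boxProd_adj.1 ((SimpleGraph.mem_edgeSet _).1 h) with h | h
      · exact (hvert v hv).1.ne h.2
      · exact h.1
    refine (Finset.sum_le_card_nsmul L _ (Real.tanh Js) fun v hv =>
      (congrArg Real.tanh (hval v hv)).le).trans ?_
    rw [nsmul_eq_mul]
    exact mul_le_mul_of_nonneg_right (mod_cast hcard) (tanh_nonneg hJs)

lemma chiFullBox_le (d s : ℕ) {Jd Js : ℝ} (hJd : 0 ≤ Jd) (hJs : 0 ≤ Js) (N : ℕ) :
    chiFullBox d s Jd Js N ≤ chiPlanarBox d Jd N +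
      chiPlanarBox d Jd N * (2 * s * Real.tanh Js) * chiFullBox d s Jd Js N :=
  susceptibilityIn_product_le hJd hJs (box_nonempty d N) (box_nonempty s N)

/-! ### The infinite-volume limit -/

lemma tendsto_limsup_ofReal {u : ℕ → ℝ} (hu : Monotone u) :
    Tendsto (fun N => ENNReal.ofReal (u N)) atTop
      (𝓝 (limsup (fun N => ENNReal.ofReal (u N)) atTop)) := by
  have h := tendsto_atTop_iSup (f := fun N => ENNReal.ofReal (u N)) fun _ _ h =>
    ENNReal.ofReal_le_ofReal (hu h)
  rwa [h.limsup_eq]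

lemma tsum_pow_mul_pow_succ (r c : ℝ≥0∞) :
    ∑' n : ℕ, r ^ n * c ^ (n + 1) = (1 - r * c)⁻¹ * c := by
  rw [← ENNReal.tsum_geometric, ← ENNReal.tsum_mul_right]
  exact tsum_congr fun n => by rw [pow_succ, mul_pow, mul_assoc]

/-- The hypothesis `X ≠ ⊤` is what allows the term `r * c * X` to be absorbed when `r * c < 1`;
when `1 ≤ r * c` the series diverges. -/
lemma le_tsum_of_le_add_mul {X r c : ℝ≥0∞} (hX : X ≠ ⊤) (hc : c ≠ 0)
    (h : X ≤ c + r * c * X) : X ≤ ∑' n : ℕ, r ^ n * c ^ (n + 1) := by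
  rw [tsum_pow_mul_pow_succ]
  rcases le_or_gt 1 (r * c) with hq | hq
  · simp [tsub_eq_zero_of_le hq, ENNReal.top_mul hc]
  · rw [mul_comm, ← div_eq_mul_inv, ENNReal.le_div_iff_mul_le
      (Or.inl (tsub_pos_of_lt hq).ne') (Or.inl (by simp)),
      ENNReal.mul_sub fun _ _ => hX, mul_one, mul_comm X, tsub_le_iff_right]
    exact h

lemma tendsto_chiPlanarBox (d : ℕ) {Jd : ℝ} (hJd : 0 ≤ Jd) :
    Tendsto (fun N => ENNReal.ofReal (chiPlanarBox d Jd N)) atTop (𝓝 (chiPlanar d Jd)) :=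
  tendsto_limsup_ofReal (chiPlanarBox_mono d hJd)

lemma tendsto_chiFullBox (d s : ℕ) {Jd Js : ℝ} (hJd : 0 ≤ Jd) (hJs : 0 ≤ Js) :
    Tendsto (fun N => ENNReal.ofReal (chiFullBox d s Jd Js N)) atTop (𝓝 (chiFull d s Jd Js)) :=
  tendsto_limsup_ofReal (chiFullBox_mono d s hJd hJs)

lemma chiFull_le_tsum (d s : ℕ) {Jd Js : ℝ} (hJd : 0 ≤ Jd) (hJs : 0 ≤ Js) :
    chiFull d s Jd Js ≤ ∑' n : ℕ, (2 * (s : ℝ≥0∞) * ENNReal.ofReal (Real.tanh Js)) ^ n *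
      chiPlanar d Jd ^ (n + 1) := by
  refine le_of_tendsto' (tendsto_chiFullBox d s hJd hJs) fun N => ?_
  have : Nonempty ↥(box d N) := (box_nonempty d N).to_subtype
  have hc1 : 1 ≤ chiPlanarBox d Jd N :=
    one_le_finiteSusceptibility (V := ↥(box d N)) _ fun _ => hJd
  have hc : ENNReal.ofReal (chiPlanarBox d Jd N) ≤ chiPlanar d Jd :=
    Monotone.ge_of_tendsto (fun _ _ h => ENNReal.ofReal_le_ofReal (chiPlanarBox_mono d hJd h))
      (tendsto_chiPlanarBox d hJd) N
  have hc0 : chiPlanar d Jd ≠ 0 :=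
    ((ENNReal.ofReal_pos.2 (zero_lt_one.trans_le hc1)).trans_le hc).ne'
  refine le_tsum_of_le_add_mul ENNReal.ofReal_ne_top hc0 ?_
  have h0 : 0 ≤ chiPlanarBox d Jd N := zero_le_one.trans hc1
  have hr : 2 * (s : ℝ≥0∞) * ENNReal.ofReal (Real.tanh Js) =
      ENNReal.ofReal (2 * s * Real.tanh Js) := by
    rw [ENNReal.ofReal_mul (by positivity), ENNReal.ofReal_mul zero_le_two]
    simp
  have ht : 0 ≤ 2 * s * Real.tanh Js := mul_nonneg (by positivity) (tanh_nonneg hJs)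
  calc ENNReal.ofReal (chiFullBox d s Jd Js N)
      ≤ ENNReal.ofReal (chiPlanarBox d Jd N +
        chiPlanarBox d Jd N * (2 * s * Real.tanh Js) * chiFullBox d s Jd Js N) :=
        ENNReal.ofReal_le_ofReal (chiFullBox_le d s hJd hJs N)
    _ ≤ ENNReal.ofReal (chiPlanarBox d Jd N) + ENNReal.ofReal (2 * s * Real.tanh Js) *
        ENNReal.ofReal (chiPlanarBox d Jd N) * ENNReal.ofReal (chiFullBox d s Jd Js N) := by
        rw [← ENNReal.ofReal_mul ht, ← ENNReal.ofReal_mul (mul_nonneg ht h0),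
          mul_comm (2 * (s : ℝ) * _)]
        exact ENNReal.ofReal_add_le
    _ ≤ _ := by rw [hr]; gcongr

end Lattice

end

end AnisotropicIsing

theorem theorem1 (d s : ℕ) (hd : 1 ≤ d) (hs : 1 ≤ s) (Jd Js : ℝ) (hJd : 0 < Jd) (hJs : 0 < Js) :
    -- the limits that define the two susceptibilities exist in `[0,∞]`
    Tendsto (fun N : ℕ => ENNReal.ofReal (AnisotropicIsing.chiPlanarBox d Jd N)) atTop
      (𝓝 (AnisotropicIsing.chiPlanar d Jd)) ∧
    Tendsto (fun N : ℕ => ENNReal.ofReal (AnisotropicIsing.chiFullBox d s Jd Js N)) atTop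
      (𝓝 (AnisotropicIsing.chiFull d s Jd Js)) ∧
    -- finiteness
    (AnisotropicIsing.chiPlanar d Jd < ⊤ →
      ENNReal.ofReal (Real.tanh Js) < 1 / (2 * (s : ℝ≥0∞) * AnisotropicIsing.chiPlanar d Jd) →
      AnisotropicIsing.chiFull d s Jd Js < ⊤) ∧
    -- the quantitative bound
    AnisotropicIsing.chiFull d s Jd Js ≤
      ∑' n : ℕ, (2 * (s : ℝ≥0∞) * ENNReal.ofReal (Real.tanh Js)) ^ n *
        AnisotropicIsing.chiPlanar d Jd ^ (n + 1) := by
  have hbound := AnisotropicIsing.chiFull_le_tsum d s hJd.le hJs.le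
  refine ⟨AnisotropicIsing.tendsto_chiPlanarBox d hJd.le,
    AnisotropicIsing.tendsto_chiFullBox d s hJd.le hJs.le,
    fun hfin hlt => hbound.trans_lt ?_, hbound⟩
  rw [AnisotropicIsing.tsum_pow_mul_pow_succ]
  refine ENNReal.mul_lt_top (ENNReal.inv_lt_top.2 (tsub_pos_of_lt ?_)) hfin
  have := ENNReal.mul_lt_of_lt_div hlt
  rwa [mul_left_comm, ← mul_assoc] at this
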